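/- Let $n\ge 0$ and $d>n$ be integers. A binary form is a homogeneous polynomial in $\mathbb C[s,t]$. Let $C,D\subset\mathbb P^n=\mathbb P^n_{\mathbb C}$ be non-degenerate rational curves of degree $d$. That is, neither curve lies in a hyperplane, and $C=\mathbf p(\mathbb P^1)$, $D=\mathbf q(\mathbb P^1)$ for morphisms $\mathbf p=[p_0:\dots:p_n]$, $\mathbf q=[q_0:\dots:q_n]$ from $\mathbb P^1$ to $\mathbb P^n$ with the following properties: the $p_i$ are binary forms of degree $d$ without a common factor, so are the $q_i$, and $\mathbf p$ and $\mathbf q$ are birational onto their images, i.e. injective outside a finite subset of $\mathbb P^1$. Let $$\Delta_{\mathbf p}(s,t)=\det\left[\frac{\partial^n\mathbf p}{\partial s^n},\ \frac{\partial^n\mathbf p}{\partial s^{n-1}\partial t},\ \dots,\ \frac{\partial^n\mathbf p}{\partial t^n}\right]$$ be the stall (osculation) form of $\mathbf p$, and let $\Delta_{\mathbf q}$ be that of $\mathbf q$. Put $$\mathrm{Aut}(\mathbb P^n)_{C,D}=\{\phi\in \mathrm{PGL}_{n+1}(\mathbb C):\ \phi(C)=D\},\qquad \mathrm{Aut}(\mathbb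 P^1)_{\Delta_{\mathbf p},\Delta_{\mathbf q}}=\{\psi\in \mathrm{PGL}_2(\mathbb C):\ \exists\,\lambda\in\mathbb C^*,\ \Delta_{\mathbf q}\circ\psi=\lambda\,\Delta_{\mathbf p}\},$$ where $\Delta_{\mathbf q}\circ\psi$ is formed with some matrix representing $\psi$. Then $\mathrm{Aut}(\mathbb P^1)_{\Delta_{\mathbf p},\Delta_{\mathbf q}}$ is a candidate set for $\mathrm{Aut}(\mathbb P^n)_{C,D}$, with inclusion $\phi\mapsto\mathbf q^{-1}\circ\phi\circ\mathbf p$. That is, there is an injective map $$\iota:\mathrm{Aut}(\mathbb P^n)_{C,D}\hookrightarrow \mathrm{Aut}(\mathbb P^1)_{\Delta_{\mathbf p},\Delta_{\mathbf q}}$$ such that, for every $\phi\in\mathrm{Aut}(\mathbb P^n)_{C,D}$, the automorphism $\iota(\phi)$ is the rational map $\mathbf q^{-1}\circ\phi\circ\mathbf p$ (for all but finitely many $x\in\mathbb P^1$, the point $\iota(\phi)(x)$ is the unique preimage of $\phi(\mathbf p(x))$ under $\mathbf q$), and $\mathbf q\circ\iota(\phi)=\phi\circ\mathbf p$ on all of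 $\mathbb P^1$. -/

import Mathlib

open scoped LinearAlgebra.Projectivization MatrixGroups

noncomputable section

namespace RatCurve

open MvPolynomial

/-- The complex projective space `ℙⁿ`, i.e. the set of lines through the origin of `ℂⁿ⁺¹`. Its
automorphism group (the group of projective transformations) is `PGL(n + 1, ℂ)`, with its Mathlib
action on `ℙ ℂ (Fin (n + 1) → ℂ)`. -/
abbrev PSpace (n : ℕ) : Type := ℙ ℂ (Fin (n + 1) → ℂ)

/-- Binary forms live in `ℂ[s, t]`, with `s = X 0` and `t = X 1`. -/
abbrev BinPoly : Type := MvPolynomial (Fin 2) ℂ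

/-- A morphism `ℙ¹ → ℙⁿ` of degree `d`: a tuple `[p₀(s,t) : ⋯ : pₙ(s,t)]` of binary forms of
degree `d` without a common factor. -/
structure Param (n d : ℕ) where
  form : Fin (n + 1) → BinPoly
  isHomogeneous : ∀ i, (form i).IsHomogeneous d
  noCommonFactor : ∀ r : BinPoly, (∀ i, r ∣ form i) → IsUnit r

/-- Homogeneity for evaluation in a `ℂ`-algebra. -/
theorem aeval_smul_of_isHomogeneous {A : Type*} [CommRing A] [Algebra ℂ A] {F : BinPoly} {d : ℕ}
    (hF : F.IsHomogeneous d) (c : A) (v : Fin 2 → ℂ) :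
    aeval (fun j => v j • c) F = eval v F • c ^ d := by
  rw [aeval_def, eval₂_eq', eval_eq', Finset.sum_smul]
  refine Finset.sum_congr rfl fun m hm => ?_
  have hd : m 0 + m 1 = d := by
    have := hF (mem_support_iff.mp hm)
    rw [Finsupp.weight_apply, Finsupp.sum_fintype _ _ (by simp)] at this
    simpa [Fin.sum_univ_two] using this
  simp only [Fin.prod_univ_two, ← hd, pow_add, Algebra.smul_def, map_mul, map_pow]
  ring

/-- A binary form vanishing at `v ≠ 0` is divisible by the linear form `v₁ s - v₀ t`. -/
theorem linear_dvd_of_eval_eq_zero {F : BinPoly} {d : ℕ} (hF : F.IsHomogeneous d)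
    {v : Fin 2 → ℂ} (hv : v ≠ 0) (h : eval v F = 0) :
    (C (v 1) * X 0 - C (v 0) * X 1 : BinPoly) ∣ F := by
  set l : BinPoly := C (v 1) * X 0 - C (v 0) * X 1 with hl
  rw [← Ideal.mem_span_singleton, ← Ideal.Quotient.eq_zero_iff_mem]
  let π : BinPoly →ₐ[ℂ] BinPoly ⧸ Ideal.span {l} := Ideal.Quotient.mkₐ ℂ _
  change π F = 0
  have hrel : v 1 • π (X 0) = v 0 • π (X 1) := by
    rw [← sub_eq_zero, ← map_smul, ← map_smul, ← map_sub, smul_eq_C_mul, smul_eq_C_mul]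
    exact Ideal.Quotient.eq_zero_iff_mem.mpr (Ideal.mem_span_singleton_self l)
  have hc : ∃ c, ∀ j, π (X j) = v j • c := by
    by_cases h0 : v 0 = 0
    · have h1 : v 1 ≠ 0 := fun h1 => hv (funext fun j => by fin_cases j <;> simp [h0, h1])
      refine ⟨(v 1)⁻¹ • π (X 1), fun j => ?_⟩
      fin_cases j
      · have : π (X 0) = 0 := by
          rw [h0, zero_smul] at hrel
          exact (smul_eq_zero.mp hrel).resolve_left h1
        simp [h0, this]
      · simp [smul_smul, h1]
    · refine ⟨(v 0)⁻¹ • π (X 0), fun j => ?_⟩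
      fin_cases j
      · simp [smul_smul, h0]
      · simp only [Fin.mk_one]
        rw [smul_comm, hrel, smul_smul, inv_mul_cancel₀ h0, one_smul]
  obtain ⟨c, hc⟩ := hc
  have : π F = aeval (fun j => π (X j)) F := by
    exact DFunLike.congr_fun (aeval_unique π) F
  rw [this, funext hc, aeval_smul_of_isHomogeneous hF, h, zero_smul]

namespace Param

variable {n d : ℕ}

/-- The value of the tuple of forms at a vector of `ℂ²`. -/
def evalAt (p : Param n d) (v : Fin 2 → ℂ) : Fin (n + 1) → ℂ := fun i => eval v (p.form i)

theorem evalAt_ne_zero (p : Param n d) {v : Fin 2 → ℂ} (hv : v ≠ 0) : p.evalAt v ≠ 0 := by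
  intro h
  have hu := p.noCommonFactor _ fun i =>
    linear_dvd_of_eval_eq_zero (p.isHomogeneous i) hv (congrFun h i)
  have := hu.map (eval v)
  simp [mul_comm] at this

theorem evalAt_smul (p : Param n d) (a : ℂ) (v : Fin 2 → ℂ) :
    p.evalAt (a • v) = a ^ d • p.evalAt v := by
  funext i
  have := aeval_smul_of_isHomogeneous (p.isHomogeneous i) a v
  simp only [evalAt, Pi.smul_apply, smul_eq_mul] at this ⊢
  rw [mul_comm, ← this]
  congr 2
  funext j
  simp [mul_comm]

/-- The morphism `ℙ¹ → ℙⁿ`, `[s : t] ↦ [p₀(s,t) : ⋯ : pₙ(s,t)]`. -/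
def toMap (p : Param n d) : PSpace 1 → PSpace n :=
  Projectivization.lift
    (fun v : {v : Fin 2 → ℂ // v ≠ 0} =>
      Projectivization.mk ℂ (p.evalAt v) (p.evalAt_ne_zero v.2))
    (by
      rintro ⟨v, hv⟩ ⟨w, hw⟩ a (rfl : v = a • w)
      rw [Projectivization.mk_eq_mk_iff']
      exact ⟨a ^ d, (p.evalAt_smul a w).symm⟩)

theorem toMap_mk (p : Param n d) {v : Fin 2 → ℂ} (hv : v ≠ 0) :
    p.toMap (Projectivization.mk ℂ v hv) =
      Projectivization.mk ℂ (p.evalAt v) (p.evalAt_ne_zero hv) := rfl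

/-- Birationality onto the image: the morphism is almost everywhere injective, i.e. injective
outside a finite subset of `ℙ¹`. -/
def IsBirational (p : Param n d) : Prop :=
  ∃ S : Set (PSpace 1), S.Finite ∧ Set.InjOn p.toMap Sᶜ

/-- The osculation (stall) form
`Δ_p = det [∂ⁿp/∂sⁿ, ∂ⁿp/∂sⁿ⁻¹∂t, …, ∂ⁿp/∂tⁿ]`; the column with index `k` is `∂ⁿp/∂sⁿ⁻ᵏ∂tᵏ`. -/
def stallForm (p : Param n d) : BinPoly :=
  Matrix.det (Matrix.of fun i k : Fin (n + 1) =>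
    (pderiv 0)^[n - (k : ℕ)] ((pderiv 1)^[(k : ℕ)] (p.form i)))

end Param

/-- `C` is the rational curve of degree `d` in `ℙⁿ` parametrized by the birational
morphism `p`. -/
structure IsRationalCurve {n d : ℕ} (C : Set (PSpace n)) (p : Param n d) : Prop where
  isBirational : p.IsBirational
  range_eq : Set.range p.toMap = C

/-- The hyperplane `a₀ x₀ + ⋯ + aₙ xₙ = 0`. -/
def hyperplane {n : ℕ} (a : Fin (n + 1) → ℂ) : Set (PSpace n) :=
  {x | ∑ i, a i * x.rep i = 0}

/-- A subset of `ℙⁿ` is non-degenerate if no hyperplane contains it. -/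
def Nondegenerate {n : ℕ} (C : Set (PSpace n)) : Prop :=
  ∀ a : Fin (n + 1) → ℂ, a ≠ 0 → ¬ C ⊆ hyperplane a

/-- `Aut(ℙⁿ)_{A,B}`: the projective transformations mapping `A` onto `B`. -/
def equivs {n : ℕ} (A B : Set (PSpace n)) : Set PGL(Fin (n + 1), ℂ) :=
  {φ | (fun x => φ • x) '' A = B}

/-- The form `G ∘ M`, i.e. `G(m₀₀ s + m₀₁ t, m₁₀ s + m₁₁ t)`. -/
def substForm (G : BinPoly) (M : GL (Fin 2) ℂ) : BinPoly :=
  bind₁ (fun i => ∑ j, C (M i j) * X j) G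

/-- `Aut(ℙ¹)_{F,G}`: the automorphisms `ψ` of `ℙ¹` such that `G ∘ ψ = lam • F` for some nonzero
complex number `lam`. -/
def formEquivs (F G : BinPoly) : Set PGL(Fin 2, ℂ) :=
  {ψ | ∃ M : GL (Fin 2) ℂ, Matrix.ProjGenLinGroup.mk M = ψ ∧
    ∃ lam : ℂ, lam ≠ 0 ∧ substForm G M = lam • F}

/-- `ψ` is the rational map `q⁻¹ ∘ φ ∘ p`: for all but finitely many `x ∈ ℙ¹`, the point `ψ(x)`
is the one and only preimage under `q` of `φ(p(x))`. -/
def IsInvComp {n d : ℕ} (q : Param n d) (φ : PGL(Fin (n + 1), ℂ)) (p : Param n d)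
    (ψ : PGL(Fin 2, ℂ)) : Prop :=
  ∀ᶠ x : PSpace 1 in Filter.cofinite, q.toMap ⁻¹' {φ • p.toMap x} = {ψ • x}

end RatCurve

end

open scoped LinearAlgebra.Projectivization MatrixGroups

namespace RatCurve

/-! Let `φ = [A]` map `C` onto `D`. Then `φ ∘ p` and `q` are generically injective with the same
image, so almost every `x` has exactly one `y` with `q(y) = φ(p(x))`. This condition is algebraic in
`(x, y)`, and one-point fibres force `y = N(x)/D(x)` for coprime polynomials
(`exists_rational_section`). The tuples `q(N, D)` and `A · p(x, 1)` are proportional without common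
zeros, hence differ by a constant (`exists_const_of_proportional`). Comparing degrees gives `max(deg
N, deg D) ≤ 1`, so the reparametrization is a matrix `M`, and `q ∘ M = c A p` holds as an identity
of forms (`exists_linSubst_eq`).

By the chain rule the osculation matrix of `q ∘ M` is that of `q`, composed with `M`, times the
invertible constant matrix by which the transpose of `M` acts on forms of degree `n`. That of `c A
p` is `c A` times the matrix of `p`. Taking determinants makes `Δ_q ∘ M` a nonzero multiple of `Δ_p`
(`mk_mem_formEquivs`).

The map is injective because `q ∘ ι(φ) = φ ∘ p` recovers `φ` on `C`, and a nondegenerate curve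
determines a projective transformation. -/

/-! ### Elimination and proportional tuples of polynomials -/

open Polynomial in
/-- An ideal of `R[X]` is, up to powers of a leading coefficient, generated by a nonzero element of
minimal degree. -/
theorem exists_dvd_leadingCoeff_pow_mul {R : Type*} [CommRing R] [IsDomain R] (I : Ideal R[X])
    (hI : I ≠ ⊥) :
    ∃ G ∈ I, G ≠ 0 ∧ ∀ F ∈ I, ∃ k : ℕ, G ∣ C (G.leadingCoeff ^ k) * F := by
  obtain ⟨G₀, hG₀, hne⟩ := Submodule.exists_mem_ne_zero_of_ne_bot hI
  let P : ℕ → Prop := fun b => ∃ G ∈ I, G ≠ 0 ∧ G.natDegree = b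
  have hP : ∃ b, P b := ⟨_, G₀, hG₀, hne, rfl⟩
  classical
  obtain ⟨G, hG, hG0, hdeg⟩ := Nat.find_spec hP
  have hmin : ∀ F ∈ I, F ≠ 0 → G.natDegree ≤ F.natDegree := fun F hF hF0 =>
    hdeg ▸ Nat.find_min' hP ⟨F, hF, hF0, rfl⟩
  refine ⟨G, hG, hG0, ?_⟩
  suffices H : ∀ m : ℕ, ∀ F ∈ I, F.degree < m → ∃ k : ℕ, G ∣ C (G.leadingCoeff ^ k) * F from
    fun F hF => H (F.natDegree + 1) F hF
      (degree_le_natDegree.trans_lt (by exact_mod_cast Nat.lt_succ_self _))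
  intro m
  induction m with
  | zero =>
    intro F _ hF
    have : F = 0 := by
      rw [← degree_eq_bot]
      simpa [Nat.WithBot.lt_zero_iff] using hF
    exact ⟨0, by simp [this]⟩
  | succ m ih =>
    intro F hF hFm
    by_cases hF0 : F = 0
    · exact ⟨0, by simp [hF0]⟩
    have hle := hmin F hF hF0
    -- Pseudo-division: `R` has no inverses, so `F` is scaled by the leading coefficient of `G`
    -- before its top term is cancelled. Each step costs one power.
    have hlt : (C G.leadingCoeff * F - C F.leadingCoeff * X ^ (F.natDegree - G.natDegree) * G).degree
        < F.degree := by
      have h1 : (C G.leadingCoeff * F).degree = F.degree := by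
        rw [degree_C_mul (leadingCoeff_ne_zero.mpr hG0)]
      rw [← h1]
      refine degree_sub_lt_left ?_ ?_ ?_
      · rw [h1, mul_assoc, degree_C_mul (leadingCoeff_ne_zero.mpr hF0), degree_mul, degree_X_pow,
          degree_eq_natDegree hF0, degree_eq_natDegree hG0]
        norm_cast
        omega
      · exact mul_ne_zero (C_ne_zero.mpr (leadingCoeff_ne_zero.mpr hG0)) hF0
      · rw [leadingCoeff_mul, leadingCoeff_mul, leadingCoeff_mul, leadingCoeff_C, leadingCoeff_C,
          leadingCoeff_X_pow, mul_one, mul_comm]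
    obtain ⟨k, hk⟩ := ih _ (I.sub_mem (I.mul_mem_left _ hF) (I.mul_mem_left _ hG))
      (hlt.trans_le (by
        rw [degree_eq_natDegree hF0] at hFm ⊢
        norm_cast at hFm ⊢
        omega))
    refine ⟨k + 1, ?_⟩
    have := dvd_add hk
      (Dvd.intro_left (C (G.leadingCoeff ^ k) * (C F.leadingCoeff * X ^ (F.natDegree - G.natDegree)))
        rfl)
    convert this using 1
    simp only [map_pow]
    ring

-- Over `ℂ` the polynomial is a constant times a power of `X - y`. In characteristic zero two
-- coefficients then determine `y` rationally, whatever the multiplicity.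
open Polynomial in
theorem coeff_natDegree_pred_of_unique_root {g : ℂ[X]} (hg : g ≠ 0) {y : ℂ}
    (hy : ∀ z, g.eval z = 0 ↔ z = y) :
    0 < g.natDegree ∧ g.coeff (g.natDegree - 1) = -(g.natDegree * y) * g.leadingCoeff := by
  have hs := IsAlgClosed.splits g
  have hroots : g.roots = Multiset.replicate g.natDegree y := by
    rw [Multiset.eq_replicate]
    refine ⟨hs.natDegree_eq_card_roots.symm, fun z hz => (hy z).mp (isRoot_of_mem_roots hz)⟩
  have hpos : 0 < g.natDegree := by
    rw [hs.natDegree_eq_card_roots]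
    exact Multiset.card_pos_iff_exists_mem.mpr ⟨y, (mem_roots hg).mpr ((hy y).mpr rfl)⟩
  refine ⟨hpos, ?_⟩
  have := hs.nextCoeff_eq_neg_sum_roots_mul_leadingCoeff
  rw [nextCoeff_of_natDegree_pos hpos, hroots, Multiset.sum_replicate] at this
  rw [this]
  simp only [nsmul_eq_mul]
  ring

open Polynomial in
theorem eventually_eval_ne_zero {D : ℂ[X]} (hD : D ≠ 0) :
    ∀ᶠ x : ℂ in Filter.cofinite, D.eval x ≠ 0 := by
  refine (D.rootSet_finite ℂ).subset fun x hx => ?_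
  simpa [mem_rootSet, hD] using hx

open Polynomial in
/-- If the fibres over almost all points of the first axis of a closed subset of the affine plane
are singletons, then the subset is almost everywhere the graph of a rational function. -/
theorem exists_rational_section (I : Ideal ℂ[X][X])
    (h : ∀ᶠ x : ℂ in Filter.cofinite,
      ∃! y : ℂ, ∀ F ∈ I, (F.map (evalRingHom x)).eval y = 0) :
    ∃ N D : ℂ[X], IsCoprime N D ∧ ∀ᶠ x : ℂ in Filter.cofinite,
      D.eval x ≠ 0 ∧ ∀ F ∈ I, (F.map (evalRingHom x)).eval (N.eval x / D.eval x) = 0 := by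
  have hI : I ≠ ⊥ := by
    -- For the zero ideal every fibre is the whole line, so both `0` and `1` would be the unique
    -- point.
    rintro rfl
    obtain ⟨x, y, -, hy⟩ := h.exists
    have h0 := hy 0 (by simp)
    have h1 := hy 1 (by simp)
    exact one_ne_zero (h1.trans h0.symm)
  obtain ⟨G, hG, hG0, hdvd⟩ := exists_dvd_leadingCoeff_pow_mul I hI
  have hlc : G.leadingCoeff ≠ 0 := leadingCoeff_ne_zero.mpr hG0
  have key : ∀ᶠ x : ℂ in Filter.cofinite, G.leadingCoeff.eval x ≠ 0 ∧ 0 < G.natDegree ∧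
      ∀ F ∈ I, (F.map (evalRingHom x)).eval (-(G.coeff (G.natDegree - 1)).eval x /
        (G.natDegree * G.leadingCoeff.eval x)) = 0 := by
    filter_upwards [h, eventually_eval_ne_zero hlc] with x ⟨y, hy, huniq⟩ hx
    have hlx : evalRingHom x G.leadingCoeff ≠ 0 := hx
    -- Where the leading coefficient of `G` does not vanish, a root of the specialized `G` kills all
    -- of `I`; so the fibre is cut out by `G` alone.
    have hroot : ∀ z, (G.map (evalRingHom x)).eval z = 0 ↔ z = y := by
      refine fun z => ⟨fun hz => huniq z fun F hF => ?_, ?_⟩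
      · obtain ⟨k, H, hH⟩ := hdvd F hF
        have := congrArg (fun P => (P.map (evalRingHom x)).eval z) hH
        simp only [Polynomial.map_mul, map_C, eval_mul, eval_C, hz, zero_mul] at this
        rw [map_pow] at this
        exact (mul_eq_zero.mp this).resolve_left (pow_ne_zero _ hlx)
      · rintro rfl
        exact hy G hG
    have hne : G.map (evalRingHom x) ≠ 0 := fun h0 => by
      have := congrArg (fun P => P.coeff G.natDegree) h0
      simp only [coeff_map, coeff_zero] at this
      exact hlx this
    have hdeg : (G.map (evalRingHom x)).natDegree = G.natDegree :=
      natDegree_map_of_leadingCoeff_ne_zero _ hlx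
    obtain ⟨hpos, hc⟩ := coeff_natDegree_pred_of_unique_root hne hroot
    rw [leadingCoeff, hdeg, coeff_map, coeff_map, coe_evalRingHom] at hc
    rw [hdeg] at hpos
    refine ⟨hx, hpos, ?_⟩
    have hb : (G.natDegree : ℂ) ≠ 0 := by exact_mod_cast hpos.ne'
    have hx' : (G.coeff G.natDegree).eval x ≠ 0 := hx
    have : -(G.coeff (G.natDegree - 1)).eval x / (G.natDegree * G.leadingCoeff.eval x) = y := by
      rw [hc, leadingCoeff]
      field_simp
    rw [this]
    exact hy
  obtain ⟨-, -, hpos, -⟩ := key.exists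
  have hb : (G.natDegree : ℂ) ≠ 0 := by exact_mod_cast hpos.ne'
  set N := -G.coeff (G.natDegree - 1) with hN
  set D := C (G.natDegree : ℂ) * G.leadingCoeff with hD
  have hD0 : D ≠ 0 := mul_ne_zero (C_ne_zero.mpr hb) hlc
  -- Cancelling the gcd makes the pair coprime and changes the quotient at no point where the gcd is
  -- nonzero.
  have hgcd : EuclideanDomain.gcd N D ≠ 0 := fun h0 =>
    hD0 (EuclideanDomain.gcd_eq_zero_iff.mp h0).2
  obtain ⟨N', hN'⟩ := EuclideanDomain.gcd_dvd_left N D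
  obtain ⟨D', hD'⟩ := EuclideanDomain.gcd_dvd_right N D
  refine ⟨N', D', ?_, ?_⟩
  · have := EuclideanDomain.gcd_eq_gcd_ab N D
    refine ⟨EuclideanDomain.gcdA N D, EuclideanDomain.gcdB N D, mul_left_cancel₀ hgcd ?_⟩
    calc _ = (EuclideanDomain.gcd N D * N') * EuclideanDomain.gcdA N D +
          (EuclideanDomain.gcd N D * D') * EuclideanDomain.gcdB N D := by ring
      _ = _ := by rw [← hN', ← hD', ← this, mul_one]
  · filter_upwards [key, eventually_eval_ne_zero hgcd] with x ⟨hx, _, hF⟩ hgx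
    have hDx : D.eval x = G.natDegree * G.leadingCoeff.eval x := by simp [hD]
    have hNx : N.eval x = -(G.coeff (G.natDegree - 1)).eval x := by simp [hN]
    have hD0x : D.eval x ≠ 0 := by rw [hDx]; exact mul_ne_zero hb hx
    rw [← hDx, ← hNx] at hF
    have eN := (congrArg (eval x) hN').trans eval_mul
    have eD := (congrArg (eval x) hD').trans eval_mul
    have hD'x : D'.eval x ≠ 0 := fun h0 => hD0x (by rw [eD, h0, mul_zero])
    refine ⟨hD'x, ?_⟩
    rwa [eN, eD, mul_div_mul_left _ _ hgx] at hF

open Polynomial in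
/-- Two proportional tuples of polynomials without common roots differ by a constant. -/
theorem exists_const_of_proportional {ι : Type*} [Finite ι] {u v : ι → ℂ[X]}
    (hu : ∀ x, ∃ i, (u i).eval x ≠ 0) (hv : ∀ x, ∃ i, (v i).eval x ≠ 0)
    (huv : ∀ i j, u i * v j = u j * v i) : ∃ c : ℂ, c ≠ 0 ∧ ∀ i, v i = C c * u i := by
  have := Fintype.ofFinite ι
  -- No common root over `ℂ` means a Bézout relation `∑ aᵢ uᵢ = 1`. Proportionality then yields `v =
  -- w u` with `w = ∑ aᵢ vᵢ`, and a root of `w` would be a common root of `v`.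
  have htop : (1 : ℂ[X]) ∈ Ideal.span (Set.range u) := by
    obtain ⟨g, hg⟩ := (IsPrincipalIdealRing.principal (Ideal.span (Set.range u))).principal
    have hg' : Ideal.span (Set.range u) = Ideal.span {g} := hg
    rw [hg', Ideal.mem_span_singleton, ← isUnit_iff_dvd_one]
    by_contra hunit
    by_cases hdeg : g.degree = 0
    · exact hunit (isUnit_iff_degree_eq_zero.mpr hdeg)
    obtain ⟨x, hx⟩ := IsAlgClosed.exists_root g hdeg
    obtain ⟨i, hi⟩ := hu x
    have : g ∣ u i := by
      rw [← Ideal.mem_span_singleton, ← hg']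
      exact Ideal.subset_span ⟨i, rfl⟩
    exact hi (eval_eq_zero_of_dvd_of_eval_eq_zero this hx)
  obtain ⟨a, ha⟩ := (Ideal.mem_span_range_iff_exists_fun).mp htop
  set w := ∑ i, a i * v i with hw
  have hvw : ∀ j, v j = w * u j := fun j => by
    calc v j = (∑ i, a i * u i) * v j := by rw [ha, one_mul]
      _ = w * u j := by
        rw [hw, Finset.sum_mul, Finset.sum_mul]
        exact Finset.sum_congr rfl fun i _ => by rw [mul_assoc, huv, mul_assoc, mul_comm (u j)]
  have hdeg : w.degree = 0 := by
    by_contra hdeg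
    obtain ⟨x, hx⟩ := IsAlgClosed.exists_root w hdeg
    obtain ⟨i, hi⟩ := hv x
    exact hi (by rw [hvw, eval_mul, hx.eq_zero, zero_mul])
  rw [eq_C_of_degree_eq_zero hdeg] at hvw
  refine ⟨w.coeff 0, fun h0 => ?_, hvw⟩
  rw [eq_C_of_degree_eq_zero hdeg, h0] at hdeg
  simp at hdeg

/-! ### Linear substitutions and the osculation determinant -/

section Osculation

open MvPolynomial

/-- The linear substitution `F ↦ F ∘ M` as an algebra homomorphism. -/
noncomputable def linSubst (M : Matrix (Fin 2) (Fin 2) ℂ) : BinPoly →ₐ[ℂ] BinPoly :=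
  bind₁ fun i => ∑ j, C (M i j) * X j

theorem substForm_eq_linSubst (F : BinPoly) (M : GL (Fin 2) ℂ) :
    substForm F M = linSubst (M : Matrix (Fin 2) (Fin 2) ℂ) F := rfl

theorem linSubst_X (M : Matrix (Fin 2) (Fin 2) ℂ) (i : Fin 2) :
    linSubst M (X i) = ∑ j, C (M i j) * X j := bind₁_X_right _ _

theorem linSubst_linSubst (A B : Matrix (Fin 2) (Fin 2) ℂ) (F : BinPoly) :
    linSubst A (linSubst B F) = linSubst (B * A) F := by
  suffices h : (linSubst A).comp (linSubst B) = linSubst (B * A) from DFunLike.congr_fun h F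
  refine MvPolynomial.algHom_ext fun i => ?_
  simp only [AlgHom.comp_apply, linSubst_X, map_mul, Fin.sum_univ_two, Matrix.mul_apply,
    map_add, algHom_C, algebraMap_eq]
  ring

theorem linSubst_one (F : BinPoly) : linSubst 1 F = F := by
  suffices h : linSubst 1 = AlgHom.id ℂ BinPoly from DFunLike.congr_fun h F
  refine MvPolynomial.algHom_ext fun i => ?_
  simp [linSubst_X, Matrix.one_apply]

theorem linSubst_injective {M : Matrix (Fin 2) (Fin 2) ℂ} (hM : IsUnit M.det) :
    Function.Injective (linSubst M) := by
  refine Function.LeftInverse.injective (g := linSubst M⁻¹) fun F => ?_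
  rw [linSubst_linSubst, Matrix.mul_nonsing_inv _ hM, linSubst_one]

theorem eval_linSubst (M : Matrix (Fin 2) (Fin 2) ℂ) (F : BinPoly) (v : Fin 2 → ℂ) :
    eval v (linSubst M F) = eval (M.mulVec v) F := by
  rw [linSubst, eval, eval₂Hom_bind₁]
  congr 2
  funext i
  simp [Matrix.mulVec, dotProduct]

theorem isHomogeneous_linSubst (M : Matrix (Fin 2) (Fin 2) ℂ) {F : BinPoly} {n : ℕ}
    (hF : F.IsHomogeneous n) : (linSubst M F).IsHomogeneous n := by
  have := hF.aeval (fun i => ∑ j, C (M i j) * X j : Fin 2 → BinPoly) (n := 1) fun i =>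
    IsHomogeneous.sum _ _ _ fun j _ => by simpa using (isHomogeneous_C_mul_X (M i j) j)
  rwa [one_mul] at this

theorem pderiv_linSubst (M : Matrix (Fin 2) (Fin 2) ℂ) (k : Fin 2) (F : BinPoly) :
    pderiv k (linSubst M F) = ∑ i, M i k • linSubst M (pderiv i F) := by
  induction F using MvPolynomial.induction_on with
  | C a => simp [linSubst]
  | add p q hp hq => simp only [map_add, hp, hq, smul_add, Finset.sum_add_distrib]
  | mul_X p j hp =>
    have hX : pderiv k (linSubst M (X j)) = C (M j k) := by
      fin_cases k <;> simp [linSubst_X, pderiv_X]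
    rw [map_mul, Derivation.leibniz, hp, hX]
    simp only [Derivation.leibniz, map_add, smul_eq_mul, map_mul, smul_eq_C_mul, pderiv_X, mul_add,
      Finset.sum_add_distrib, Pi.single_apply]
    congr 1
    · simp [apply_ite, mul_comm]
    · rw [Finset.mul_sum]
      exact Finset.sum_congr rfl fun i _ => by ring

theorem pderiv_comm (i j : Fin 2) (F : BinPoly) : pderiv i (pderiv j F) = pderiv j (pderiv i F) := by
  induction F using MvPolynomial.induction_on with
  | C a => simp
  | add p q hp hq => simp only [map_add, hp, hq]
  | mul_X p k hp =>
    have h : ∀ a b c : Fin 2, pderiv a (pderiv b (X c : BinPoly)) = 0 := fun a b c => by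
      rw [pderiv_X, Pi.single_apply]
      split_ifs <;> simp
    simp only [Derivation.leibniz, map_add, smul_eq_mul, hp, h]
    ring

/-- Polynomials act as differential operators with constant coefficients. -/
theorem exists_diffOp : ∃ π : BinPoly →ₐ[ℂ] Module.End ℂ BinPoly,
    ∀ i F, π (X i) F = pderiv i F := by
  let s : Set (Module.End ℂ BinPoly) :=
    Set.range fun i : Fin 2 => (pderiv i : Derivation ℂ BinPoly BinPoly).toLinearMap
  have hcomm : ∀ a ∈ s, ∀ b ∈ s, a * b = b * a := by
    rintro _ ⟨i, rfl⟩ _ ⟨j, rfl⟩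
    exact LinearMap.ext fun F => pderiv_comm i j F
  -- `aeval` needs a commutative target, so the operators are taken in the subalgebra generated by
  -- the commuting partial derivatives.
  let _ : CommRing (Algebra.adjoin ℂ s) :=
    { (inferInstance : Ring (Algebra.adjoin ℂ s)) with
      mul_comm := (Algebra.isMulCommutative_adjoin ℂ hcomm).is_comm.comm }
  let g : Fin 2 → Algebra.adjoin ℂ s := fun i => ⟨_, Algebra.subset_adjoin ⟨i, rfl⟩⟩
  refine ⟨(Algebra.adjoin ℂ s).val.comp (aeval g), fun i F => ?_⟩
  rw [AlgHom.comp_apply, aeval_X]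
  rfl

/-- The differential operator with constant coefficients and symbol `G`. -/
noncomputable def diffOp : BinPoly →ₐ[ℂ] Module.End ℂ BinPoly := exists_diffOp.choose

theorem diffOp_X (i : Fin 2) (F : BinPoly) : diffOp (X i) F = pderiv i F :=
  exists_diffOp.choose_spec i F

theorem diffOp_X_pow (i : Fin 2) (m : ℕ) (F : BinPoly) :
    diffOp (X i ^ m) F = (pderiv i)^[m] F := by
  rw [map_pow, Module.End.pow_apply]
  congr 1
  exact funext (diffOp_X i)

/-- Chain rule for a linear substitution. -/
theorem diffOp_linSubst (M : Matrix (Fin 2) (Fin 2) ℂ) (G F : BinPoly) :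
    diffOp G (linSubst M F) = linSubst M (diffOp (linSubst M.transpose G) F) := by
  induction G using MvPolynomial.induction_on generalizing F with
  | C a =>
    have h : ∀ H : BinPoly, diffOp (C a) H = a • H := fun H => by
      rw [← algebraMap_eq, AlgHom.commutes]
      rfl
    rw [h, ← algebraMap_eq, AlgHom.commutes, algebraMap_eq, h, map_smul]
  | add p q hp hq => simp only [map_add, LinearMap.add_apply, hp, hq]
  | mul_X p k hp =>
    rw [map_mul, Module.End.mul_apply, diffOp_X, pderiv_linSubst, map_sum, map_mul, map_mul,
      Module.End.mul_apply, linSubst_X, map_sum, LinearMap.sum_apply, map_sum, map_sum]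
    refine Finset.sum_congr rfl fun i _ => ?_
    rw [map_smul, hp, Matrix.transpose_apply, ← smul_eq_C_mul, map_smul, LinearMap.smul_apply,
      diffOp_X, map_smul, map_smul]

/-- The monomial `sⁿ⁻ᵏtᵏ`. -/
noncomputable def binMonomial (n k : ℕ) : BinPoly := X 0 ^ (n - k) * X 1 ^ k

theorem diffOp_binMonomial (n k : ℕ) (F : BinPoly) :
    diffOp (binMonomial n k) F = (pderiv 0)^[n - k] ((pderiv 1)^[k] F) := by
  rw [binMonomial, map_mul, Module.End.mul_apply, diffOp_X_pow, diffOp_X_pow]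

theorem binMonomial_eq_monomial (n k : ℕ) :
    binMonomial n k = monomial (Finsupp.single 0 (n - k) + Finsupp.single 1 k) 1 := by
  rw [binMonomial, X_pow_eq_monomial, X_pow_eq_monomial, monomial_mul, one_mul]

theorem isHomogeneous_binMonomial (n : ℕ) (k : Fin (n + 1)) :
    (binMonomial n k).IsHomogeneous n := by
  have := (isHomogeneous_X_pow (R := ℂ) (0 : Fin 2) (n - k)).mul
    (isHomogeneous_X_pow (1 : Fin 2) (k : ℕ))
  rwa [Nat.sub_add_cancel (Nat.lt_succ_iff.mp k.2)] at this

theorem linearIndependent_binMonomial (n : ℕ) :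
    LinearIndependent ℂ fun k : Fin (n + 1) => binMonomial n k := by
  have hinj : Function.Injective fun k : Fin (n + 1) =>
      (Finsupp.single 0 (n - (k : ℕ)) + Finsupp.single 1 (k : ℕ) : Fin 2 →₀ ℕ) := by
    intro k l h
    simpa [Fin.val_inj] using DFunLike.congr_fun h 1
  have := (basisMonomials (Fin 2) ℂ).linearIndependent.comp _ hinj
  rwa [show ⇑(basisMonomials (Fin 2) ℂ) ∘ _ = fun k : Fin (n + 1) => binMonomial n k from
    funext fun k => by simp [binMonomial_eq_monomial]] at this

theorem exists_eq_sum_binMonomial {n : ℕ} {F : BinPoly} (hF : F.IsHomogeneous n) :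
    ∃ c : Fin (n + 1) → ℂ, F = ∑ l, c l • binMonomial n l := by
  suffices h : F ∈ Submodule.span ℂ (Set.range fun k : Fin (n + 1) => binMonomial n k) by
    obtain ⟨c, hc⟩ := (Submodule.mem_span_range_iff_exists_fun ℂ).mp h
    exact ⟨c, hc.symm⟩
  rw [F.as_sum]
  refine Submodule.sum_mem _ fun m hm => ?_
  have hd : m 0 + m 1 = n := by
    have := hF (mem_support_iff.mp hm)
    rw [Finsupp.weight_apply, Finsupp.sum_fintype _ _ (by simp)] at this
    simpa [Fin.sum_univ_two] using this
  have hm' : monomial m (coeff m F) = coeff m F • binMonomial n (m 1) := by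
    rw [binMonomial_eq_monomial, smul_monomial, smul_eq_mul, mul_one]
    have : m = Finsupp.single 0 (n - m 1) + Finsupp.single 1 (m 1) := by
      rw [← hd, Nat.add_sub_cancel]
      exact Finsupp.ext fun i => by fin_cases i <;> simp
    rw [← this]
  rw [hm']
  exact Submodule.smul_mem _ _ (Submodule.subset_span ⟨⟨m 1, by omega⟩, rfl⟩)

/-- The action of an invertible matrix on binary forms of degree `n` is invertible. -/
theorem exists_det_ne_zero_linSubst_binMonomial {M : Matrix (Fin 2) (Fin 2) ℂ}
    (hM : IsUnit M.det) (n : ℕ) :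
    ∃ T : Matrix (Fin (n + 1)) (Fin (n + 1)) ℂ, T.det ≠ 0 ∧
      ∀ k : Fin (n + 1), linSubst M (binMonomial n k) = ∑ l, T l k • binMonomial n l := by
  choose T hT using fun k : Fin (n + 1) =>
    exists_eq_sum_binMonomial (isHomogeneous_linSubst M (isHomogeneous_binMonomial n k))
  refine ⟨Matrix.of fun l k => T k l, fun h0 => ?_, hT⟩
  -- A kernel vector of the coefficient matrix would be a nonzero form killed by the injective
  -- substitution.
  obtain ⟨c, hc0, hc⟩ := Matrix.exists_mulVec_eq_zero_iff.mpr h0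
  have hsum : linSubst M (∑ k, c k • binMonomial n k) = 0 := by
    simp only [map_sum, map_smul, hT, Finset.smul_sum]
    rw [Finset.sum_comm]
    refine Finset.sum_eq_zero fun l _ => ?_
    have := congrFun hc l
    simp only [Matrix.mulVec, dotProduct, Matrix.of_apply, Pi.zero_apply] at this
    simp only [smul_smul, ← Finset.sum_smul]
    rw [Finset.sum_congr rfl fun k _ => mul_comm (c k) (T k l), this, zero_smul]
  rw [map_eq_zero_iff _ (linSubst_injective hM)] at hsum
  exact hc0 (funext (Fintype.linearIndependent_iff.mp (linearIndependent_binMonomial n) c hsum))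

/-- The matrix of partial derivatives of order `n` of a tuple of `n + 1` binary forms. -/
noncomputable def oscMatrix {n : ℕ} (f : Fin (n + 1) → BinPoly) :
    Matrix (Fin (n + 1)) (Fin (n + 1)) BinPoly :=
  Matrix.of fun i k => diffOp (binMonomial n k) (f i)

theorem Param.stallForm_eq_det_oscMatrix {n d : ℕ} (p : Param n d) :
    p.stallForm = (oscMatrix p.form).det := by
  simp only [Param.stallForm, oscMatrix, diffOp_binMonomial]

theorem det_oscMatrix_linComb {n : ℕ} (A : Matrix (Fin (n + 1)) (Fin (n + 1)) ℂ)
    (f : Fin (n + 1) → BinPoly) :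
    (oscMatrix fun i => ∑ j, A i j • f j).det = A.det • (oscMatrix f).det := by
  have : (oscMatrix fun i => ∑ j, A i j • f j) = A.map (C : ℂ →+* BinPoly) * oscMatrix f := by
    ext1 i k
    simp only [oscMatrix, Matrix.mul_apply, Matrix.of_apply, Matrix.map_apply, map_sum, map_smul]
    simp only [smul_eq_C_mul]
  rw [this, Matrix.det_mul, smul_eq_C_mul, RingHom.map_det]
  rfl

/-- The chain rule substitutes the transpose of `M` into the symbols, mixing the columns by a
constant invertible matrix. Its determinant `c` depends only on `M` and `n`. -/
theorem exists_det_oscMatrix_linSubst {M : Matrix (Fin 2) (Fin 2) ℂ} (hM : IsUnit M.det) (n : ℕ) :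
    ∃ c : ℂ, c ≠ 0 ∧ ∀ f : Fin (n + 1) → BinPoly,
      (oscMatrix fun i => linSubst M (f i)).det = c • linSubst M (oscMatrix f).det := by
  obtain ⟨T, hT, hTM⟩ :=
    exists_det_ne_zero_linSubst_binMonomial (M := M.transpose) (by rwa [Matrix.det_transpose]) n
  refine ⟨T.det, hT, fun f => ?_⟩
  have : (oscMatrix fun i => linSubst M (f i)) =
      (linSubst M).mapMatrix (oscMatrix f) * T.map (C : ℂ →+* BinPoly) := by
    ext1 i k
    simp only [oscMatrix, Matrix.mul_apply, Matrix.of_apply, Matrix.map_apply, map_sum, map_smul,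
      diffOp_linSubst, hTM, AlgHom.mapMatrix_apply, LinearMap.sum_apply, LinearMap.smul_apply]
    simp only [smul_eq_C_mul, mul_comm]
  rw [this, Matrix.det_mul, ← AlgHom.map_det, smul_eq_C_mul, RingHom.map_det, mul_comm]
  rfl

end Osculation

/-! ### Affine points and dehomogenization -/

section Affine

open Polynomial

/-- The point `[x : 1]` of the projective line. -/
noncomputable def affinePoint (x : ℂ) : PSpace 1 :=
  Projectivization.mk ℂ ![x, 1] fun h => one_ne_zero (congrFun h 1)

/-- Cross-multiplication turns equality of projective points into polynomial equations. -/
theorem mk_eq_mk_iff_mul_eq_mul {ι : Type*} {v w : ι → ℂ} (hv : v ≠ 0) (hw : w ≠ 0) :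
    Projectivization.mk ℂ v hv = Projectivization.mk ℂ w hw ↔
      ∀ i j, v i * w j = v j * w i := by
  rw [Projectivization.mk_eq_mk_iff']
  constructor
  · rintro ⟨a, rfl⟩ i j
    simp only [Pi.smul_apply, smul_eq_mul]
    ring
  · intro h
    obtain ⟨j, hj⟩ := Function.ne_iff.mp hw
    rw [Pi.zero_apply] at hj
    refine ⟨v j / w j, funext fun i => ?_⟩
    simp only [Pi.smul_apply, smul_eq_mul]
    rw [div_mul_eq_mul_div, div_eq_iff hj, h]

theorem affinePoint_injective : Function.Injective affinePoint := fun x y h => by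
  simpa using (mk_eq_mk_iff_mul_eq_mul _ _).mp h 0 1

theorem mk_eq_affinePoint {v : Fin 2 → ℂ} (hv : v ≠ 0) (h1 : v 1 ≠ 0) :
    Projectivization.mk ℂ v hv = affinePoint (v 0 / v 1) := by
  rw [affinePoint, mk_eq_mk_iff_mul_eq_mul, Fin.forall_fin_two]
  simp [Fin.forall_fin_two]
  field_simp
  simp

theorem finite_compl_range_affinePoint : (Set.range affinePoint)ᶜ.Finite := by
  refine (Set.finite_singleton
    (Projectivization.mk ℂ ![1, 0] fun h => one_ne_zero (congrFun h 0))).subset fun x hx => ?_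
  induction x using Projectivization.ind with
  | _ v hv =>
    have h1 : v 1 = 0 := by
      by_contra h1
      exact hx ⟨_, (mk_eq_affinePoint hv h1).symm⟩
    rw [Set.mem_singleton_iff, mk_eq_mk_iff_mul_eq_mul]
    simp [Fin.forall_fin_two, h1]

theorem eventually_affinePoint {P : PSpace 1 → Prop} (h : ∀ᶠ x in Filter.cofinite, P x) :
    ∀ᶠ x : ℂ in Filter.cofinite, P (affinePoint x) :=
  affinePoint_injective.tendsto_cofinite.eventually h

theorem eq_of_eventually_eval_eq {F G : ℂ[X]}
    (h : ∀ᶠ x : ℂ in Filter.cofinite, F.eval x = G.eval x) : F = G := by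
  refine eq_of_infinite_eval_eq F G ?_
  exact Filter.frequently_cofinite_iff_infinite.mp h.frequently

theorem eval_aeval_pair (N D : ℂ[X]) (F : BinPoly) (x : ℂ) :
    (MvPolynomial.aeval ![N, D] F).eval x = MvPolynomial.eval ![N.eval x, D.eval x] F := by
  rw [← coe_evalRingHom, MvPolynomial.map_aeval, MvPolynomial.eval]
  congr 2
  · ext a
    simp
  · funext j
    fin_cases j <;> simp

theorem add_eq_of_mem_support {F : BinPoly} {d : ℕ} (hF : F.IsHomogeneous d) {m : Fin 2 →₀ ℕ}
    (hm : m ∈ F.support) : m 0 + m 1 = d := by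
  have := hF (MvPolynomial.mem_support_iff.mp hm)
  rw [Finsupp.weight_apply, Finsupp.sum_fintype _ _ (by simp)] at this
  simpa [Fin.sum_univ_two] using this

/-- Each monomial has total degree `d`, so its top coefficient is the same monomial in the
coefficients at `e`. This detects the exact degree of a composed tuple. -/
theorem coeff_aeval_pair {N D : ℂ[X]} {e d : ℕ} (hN : N.natDegree ≤ e) (hD : D.natDegree ≤ e)
    {F : BinPoly} (hF : F.IsHomogeneous d) :
    (MvPolynomial.aeval ![N, D] F).coeff (d * e) =
      MvPolynomial.eval ![N.coeff e, D.coeff e] F := by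
  rw [MvPolynomial.aeval_def, MvPolynomial.eval₂_eq', MvPolynomial.eval_eq', finsetSum_coeff]
  refine Finset.sum_congr rfl fun m hm => ?_
  rw [← add_eq_of_mem_support hF hm, algebraMap_eq, coeff_C_mul, Fin.prod_univ_two,
    Fin.prod_univ_two, add_mul]
  simp only [Matrix.cons_val_zero, Matrix.cons_val_one]
  rw [coeff_mul_add_eq_of_natDegree_le (natDegree_pow_le_of_le _ hN)
    (natDegree_pow_le_of_le _ hD), coeff_pow_of_natDegree_le hN, coeff_pow_of_natDegree_le hD]

/-- The dehomogenization `F(x, 1)` of a binary form. -/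
noncomputable def dehom (F : BinPoly) : ℂ[X] := MvPolynomial.aeval ![X, 1] F

theorem eval_dehom (F : BinPoly) (x : ℂ) : (dehom F).eval x = MvPolynomial.eval ![x, 1] F := by
  rw [dehom, eval_aeval_pair, eval_X, eval_one]

theorem natDegree_dehom_le {F : BinPoly} {d : ℕ} (hF : F.IsHomogeneous d) :
    (dehom F).natDegree ≤ d := by
  rw [dehom, MvPolynomial.aeval_def, MvPolynomial.eval₂_eq']
  refine natDegree_sum_le_of_forall_le _ _ fun m hm => ?_
  rw [algebraMap_eq]
  refine (natDegree_C_mul_le _ _).trans ?_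
  rw [Fin.prod_univ_two]
  simp only [Matrix.cons_val_zero, Matrix.cons_val_one, one_pow, mul_one, natDegree_X_pow]
  exact (Nat.le_add_right _ _).trans (add_eq_of_mem_support hF hm).le

theorem eval_smul_of_isHomogeneous {F : BinPoly} {d : ℕ} (hF : F.IsHomogeneous d) (a : ℂ)
    (v : Fin 2 → ℂ) : MvPolynomial.eval (a • v) F = a ^ d * MvPolynomial.eval v F := by
  have := aeval_smul_of_isHomogeneous hF a v
  rw [smul_eq_mul, mul_comm] at this
  rw [← this, MvPolynomial.aeval_eq_eval]
  congr 2
  funext j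
  simp [mul_comm]

theorem eq_zero_of_eval_affine_eq_zero {F : BinPoly} {d : ℕ} (hF : F.IsHomogeneous d)
    (h : ∀ x, MvPolynomial.eval ![x, 1] F = 0) : F = 0 := by
  -- The factor `t` makes the product vanish at infinity as well, so only affine points need
  -- checking.
  have hX : F * MvPolynomial.X 1 = 0 := by
    refine MvPolynomial.funext fun v => ?_
    rw [map_mul, MvPolynomial.eval_X, map_zero]
    by_cases h1 : v 1 = 0
    · rw [h1, mul_zero]
    · have hv : v = v 1 • ![v 0 / v 1, 1] := by
        funext j
        fin_cases j
        · simp [mul_div_cancel₀ _ h1]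
        · simp
      rw [hv, eval_smul_of_isHomogeneous hF, h, mul_zero, zero_mul]
  exact (mul_eq_zero.mp hX).resolve_right (MvPolynomial.X_ne_zero 1)

end Affine

/-- Two generically injective maps with the same image match up points one to one outside
finite sets. -/
theorem eventually_exists_unique_preimage {α β : Type*} {f g : α → β}
    (hfg : Set.range f = Set.range g) {S T E : Set α} (hS : S.Finite) (hf : Set.InjOn f Sᶜ)
    (hT : T.Finite) (hg : Set.InjOn g Tᶜ) (hE : E.Finite) :
    ∀ᶠ x in Filter.cofinite, ∃ y ∉ E, ∀ z, g z = f x ↔ z = y := by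
  -- The bad `x` are those with `f x` in the finite set `g '' (T ∪ E)`; apart from `S`, there are
  -- finitely many since `f` is injective there.
  have hfin : (f ⁻¹' (g '' (T ∪ E))).Finite := by
    have h1 : (Sᶜ ∩ f ⁻¹' (g '' (T ∪ E))).Finite :=
      Set.Finite.of_finite_image (((hT.union hE).image g).subset (by
        rintro _ ⟨x, hx, rfl⟩
        exact hx.2)) (hf.mono Set.inter_subset_left)
    refine (hS.union h1).subset fun x hx => ?_
    by_cases hxS : x ∈ S
    · exact Or.inl hxS
    · exact Or.inr ⟨hxS, hx⟩
  filter_upwards [hfin.compl_mem_cofinite] with x hx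
  have hz : ∀ z, g z = f x → z ∉ T ∪ E := fun z hz hmem => hx ⟨z, hmem, hz⟩
  obtain ⟨y, hy⟩ := hfg.le ⟨x, rfl⟩
  refine ⟨y, fun hyE => hz y hy (Or.inr hyE), fun z => ⟨fun h => ?_, fun h => h ▸ hy⟩⟩
  exact hg (fun hzT => hz z h (Or.inl hzT)) (fun hyT => hz y hy (Or.inl hyT)) (h.trans hy.symm)

/-! ### The reparametrization is a linear substitution -/

section Reparametrization

open Polynomial

variable {n d : ℕ}

/-- The affine parametrization `x ↦ A · p(x, 1)`. -/
noncomputable def affineTuple (A : GL (Fin (n + 1)) ℂ) (p : Param n d) (i : Fin (n + 1)) : ℂ[X] :=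
  ∑ j, C (A i j) * dehom (p.form j)

theorem eval_affineTuple (A : GL (Fin (n + 1)) ℂ) (p : Param n d) (x : ℂ) (i : Fin (n + 1)) :
    (affineTuple A p i).eval x = (A • p.evalAt ![x, 1]) i := by
  simp only [affineTuple, eval_finsetSum, eval_mul, eval_C, eval_dehom]
  rfl

theorem Param.evalAt_affine_ne_zero (p : Param n d) (x : ℂ) : p.evalAt ![x, 1] ≠ 0 :=
  p.evalAt_ne_zero fun h => one_ne_zero (congrFun h 1)

theorem eval_affineTuple_ne_zero (A : GL (Fin (n + 1)) ℂ) (p : Param n d) (x : ℂ) :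
    (fun i => (affineTuple A p i).eval x) ≠ 0 := by
  rw [show (fun i => (affineTuple A p i).eval x) = A • p.evalAt ![x, 1] from
    funext (eval_affineTuple A p x)]
  exact (smul_ne_zero_iff_ne A).mpr (p.evalAt_affine_ne_zero x)

theorem mk_smul_toMap_affinePoint (A : GL (Fin (n + 1)) ℂ) (p : Param n d) (x : ℂ) :
    (Matrix.ProjGenLinGroup.mk A : PGL(Fin (n + 1), ℂ)) • p.toMap (affinePoint x) =
      Projectivization.mk ℂ _ (eval_affineTuple_ne_zero A p x) := by
  rw [affinePoint, Param.toMap_mk, Projectivization.PGL.mk_smul_mk]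
  congr 1
  exact (funext (eval_affineTuple A p x)).symm

theorem natDegree_affineTuple_le (A : GL (Fin (n + 1)) ℂ) (p : Param n d) (i : Fin (n + 1)) :
    (affineTuple A p i).natDegree ≤ d :=
  natDegree_sum_le_of_forall_le _ _ fun j _ =>
    (natDegree_C_mul_le _ _).trans (natDegree_dehom_le (p.isHomogeneous j))

theorem not_forall_affine_eq {β : Type*} {f : PSpace 1 → β} {S : Set (PSpace 1)} (hS : S.Finite)
    (hf : Set.InjOn f Sᶜ) : ¬ ∀ x y, f (affinePoint x) = f (affinePoint y) := by
  intro h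
  have hinf : (affinePoint ⁻¹' Sᶜ).Infinite := by
    rw [Set.preimage_compl]
    exact (hS.preimage affinePoint_injective.injOn).infinite_compl
  obtain ⟨x, hx, y, hy, hxy⟩ := hinf.nontrivial
  exact hxy (affinePoint_injective (hf hx hy (h x y)))

/-- The equations of the correspondence `{(x, y) | u(x) ∼ q(y)}`. -/
noncomputable def correspondence (u w : Fin (n + 1) → ℂ[X]) : Ideal ℂ[X][X] :=
  Ideal.span (Set.range fun ij : Fin (n + 1) × Fin (n + 1) =>
    C (u ij.1) * (w ij.2).map C - C (u ij.2) * (w ij.1).map C)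

theorem correspondence_vanish_iff (u w : Fin (n + 1) → ℂ[X]) (x y : ℂ) :
    (∀ F ∈ correspondence u w, (F.map (evalRingHom x)).eval y = 0) ↔
      ∀ i j, (u i).eval x * (w j).eval y = (u j).eval x * (w i).eval y := by
  let ψ : ℂ[X][X] →+* ℂ := (evalRingHom y).comp (mapRingHom (evalRingHom x))
  have hψ : ∀ i j, ψ (C (u i) * (w j).map C - C (u j) * (w i).map C) =
      (u i).eval x * (w j).eval y - (u j).eval x * (w i).eval y := by
    intro i j
    have hC : (evalRingHom x).comp (C : ℂ →+* ℂ[X]) = RingHom.id ℂ := by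
      ext
      simp
    simp [ψ, Polynomial.map_map, hC]
  change (correspondence u w ≤ RingHom.ker ψ) ↔ _
  rw [correspondence, Ideal.span_le, Set.range_subset_iff, Prod.forall]
  refine forall_congr' fun i => forall_congr' fun j => ?_
  rw [SetLike.mem_coe, RingHom.mem_ker, hψ, sub_eq_zero]

/-- Two generically injective parametrizations, of the same degree, of projectively equivalent
curves differ by an automorphism of the projective line. -/
theorem exists_linSubst_eq (hd : 0 < d) (p q : Param n d) (A : GL (Fin (n + 1)) ℂ)
    (hp : p.IsBirational) (hq : q.IsBirational)
    (hrange : (Set.range fun x => (Matrix.ProjGenLinGroup.mk A : PGL(Fin (n + 1), ℂ)) • p.toMap x) =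
      Set.range q.toMap) :
    ∃ M : GL (Fin 2) ℂ, ∃ c : ℂ, c ≠ 0 ∧ ∀ i,
      linSubst (M : Matrix (Fin 2) (Fin 2) ℂ) (q.form i) = ∑ j, (c * A i j) • p.form j := by
  set f : PSpace 1 → PSpace n :=
    fun x => (Matrix.ProjGenLinGroup.mk A : PGL(Fin (n + 1), ℂ)) • p.toMap x with hf
  obtain ⟨S, hS, hpS⟩ := hp
  obtain ⟨T, hT, hqT⟩ := hq
  have hfS : Set.InjOn f Sᶜ := fun x hx y hy h => hpS hx hy (MulAction.injective _ h)
  set u := affineTuple A p with hu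
  set w := fun j => dehom (q.form j) with hw
  have hfu : ∀ x, f (affinePoint x) = Projectivization.mk ℂ _ (eval_affineTuple_ne_zero A p x) :=
    mk_smul_toMap_affinePoint A p
  have hvanish : ∀ x y, (∀ F ∈ correspondence u w, (F.map (evalRingHom x)).eval y = 0) ↔
      q.toMap (affinePoint y) = f (affinePoint x) := fun x y => by
    rw [correspondence_vanish_iff, hfu, affinePoint, Param.toMap_mk, eq_comm,
      mk_eq_mk_iff_mul_eq_mul]
    simp only [hw, eval_dehom]
    rfl
  have hsection : ∀ᶠ x : ℂ in Filter.cofinite,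
      ∃! y : ℂ, ∀ F ∈ correspondence u w, (F.map (evalRingHom x)).eval y = 0 := by
    -- The exceptional set `E` is the point at infinity, so the generic preimage is affine.
    filter_upwards [eventually_affinePoint (eventually_exists_unique_preimage hrange hS hfS hT hqT
      finite_compl_range_affinePoint)] with x ⟨y, hy, huniq⟩
    obtain ⟨y, rfl⟩ := not_not.mp hy
    refine ⟨y, (hvanish x y).mpr ((huniq _).mpr rfl), fun z hz => ?_⟩
    exact affinePoint_injective ((huniq _).mp ((hvanish x z).mp hz))
  obtain ⟨N, D, hcop, hND⟩ := exists_rational_section _ hsection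
  have hND0 : ∀ x, ![N.eval x, D.eval x] ≠ 0 := fun x h => by
    obtain ⟨a, b, hab⟩ := hcop
    have := congrArg (eval x) hab
    have h0 : N.eval x = 0 := congrFun h 0
    have h1 : D.eval x = 0 := congrFun h 1
    simp [h0, h1] at this
  set v := fun j => MvPolynomial.aeval ![N, D] (q.form j) with hv
  have hvx : ∀ x j, (v j).eval x = q.evalAt ![N.eval x, D.eval x] j := fun x j =>
    eval_aeval_pair N D (q.form j) x
  have huv : ∀ i j, u i * v j = u j * v i := fun i j => by
    refine eq_of_eventually_eval_eq ?_
    filter_upwards [hND] with x ⟨hDx, hx⟩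
    have hpt : Projectivization.mk ℂ _ (hND0 x) = affinePoint (N.eval x / D.eval x) :=
      mk_eq_affinePoint (hND0 x) hDx
    rw [hvanish, ← hpt, hfu, eq_comm, Param.toMap_mk, mk_eq_mk_iff_mul_eq_mul] at hx
    rw [eval_mul, eval_mul, hvx, hvx]
    exact hx i j
  obtain ⟨c, hc, hcv⟩ := exists_const_of_proportional
    (fun x => Function.ne_iff.mp (eval_affineTuple_ne_zero A p x))
    (fun x => by
      obtain ⟨i, hi⟩ := Function.ne_iff.mp (q.evalAt_ne_zero (hND0 x))
      exact ⟨i, by rw [hvx]; exact hi⟩) huv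
  -- With `e = max (deg N) (deg D)`, the coefficients of the `v i` at `d * e` form the value of `q`
  -- at a nonzero vector, so one is nonzero. As `v i` is a constant times `u i`, of degree at most
  -- `d`, this gives `e ≤ 1`.
  obtain ⟨hN1, hD1⟩ : N.natDegree ≤ 1 ∧ D.natDegree ≤ 1 := by
    set e := max N.natDegree D.natDegree with he
    have hlead : ![N.coeff e, D.coeff e] ≠ 0 := fun h => by
      have h0 : N.coeff e = 0 := congrFun h 0
      have h1 : D.coeff e = 0 := congrFun h 1
      have hboth : N = 0 ∧ D = 0 := by
        rcases max_choice N.natDegree D.natDegree with hm | hm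
        · have hN : N = 0 := by rwa [he, hm, coeff_natDegree, leadingCoeff_eq_zero] at h0
          refine ⟨hN, ?_⟩
          have : e = 0 := by rw [he, hm, hN, natDegree_zero]
          have hD : D.natDegree = e := by
            have := le_max_right N.natDegree D.natDegree
            omega
          rwa [← hD, coeff_natDegree, leadingCoeff_eq_zero] at h1
        · have hD : D = 0 := by rwa [he, hm, coeff_natDegree, leadingCoeff_eq_zero] at h1
          refine ⟨?_, hD⟩
          have : e = 0 := by rw [he, hm, hD, natDegree_zero]
          have hN : N.natDegree = e := by
            have := le_max_left N.natDegree D.natDegree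
            omega
          rwa [← hN, coeff_natDegree, leadingCoeff_eq_zero] at h0
      exact hND0 0 (by simp [hboth.1, hboth.2])
    obtain ⟨i, hi⟩ := Function.ne_iff.mp (q.evalAt_ne_zero hlead)
    have hcoeff : (v i).coeff (d * e) ≠ 0 := by
      rw [hv, coeff_aeval_pair (le_max_left _ _) (le_max_right _ _) (q.isHomogeneous i)]
      exact hi
    have hle : d * e ≤ d * 1 := by
      rw [mul_one]
      refine (le_natDegree_of_ne_zero hcoeff).trans ?_
      rw [hcv]
      exact (natDegree_C_mul_le _ _).trans (natDegree_affineTuple_le A p i)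
    have he1 := Nat.le_of_mul_le_mul_left hle hd
    exact ⟨(le_max_left _ _).trans he1, (le_max_right _ _).trans he1⟩
  have hNx : ∀ x, N.eval x = N.coeff 1 * x + N.coeff 0 := fun x => by
    conv_lhs => rw [eq_X_add_C_of_natDegree_le_one hN1]
    simp
  have hDx : ∀ x, D.eval x = D.coeff 1 * x + D.coeff 0 := fun x => by
    conv_lhs => rw [eq_X_add_C_of_natDegree_le_one hD1]
    simp
  set M : Matrix (Fin 2) (Fin 2) ℂ := !![N.coeff 1, N.coeff 0; D.coeff 1, D.coeff 0] with hM
  have hMx : ∀ x, M.mulVec ![x, 1] = ![N.eval x, D.eval x] := fun x => by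
    rw [hNx, hDx, hM]
    funext j
    fin_cases j <;> simp [Matrix.mulVec, dotProduct]
  have hfx : ∀ x, f (affinePoint x) = q.toMap (Projectivization.mk ℂ _ (hND0 x)) := fun x => by
    rw [hfu, Param.toMap_mk, mk_eq_mk_iff_mul_eq_mul]
    intro i j
    rw [← hvx, ← hvx, ← eval_mul, ← eval_mul, huv]
  -- A singular `M` would make `[N : D]` constant, hence `f` constant on the affine line, against
  -- generic injectivity.
  have hdet : M.det ≠ 0 := fun h0 => by
    refine not_forall_affine_eq hS hfS fun x y => ?_
    rw [hfx, hfx]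
    congr 1
    rw [hM, Matrix.det_fin_two_of] at h0
    have key : N.eval x * D.eval y = D.eval x * N.eval y := by
      rw [hNx, hNx, hDx, hDx]
      linear_combination (x - y) * h0
    rw [mk_eq_mk_iff_mul_eq_mul]
    simp [Fin.forall_fin_two, key]
  refine ⟨Matrix.GeneralLinearGroup.mkOfDetNeZero M hdet, c, hc, fun i => ?_⟩
  rw [← sub_eq_zero]
  refine eq_zero_of_eval_affine_eq_zero (d := d) ?_ fun x => ?_
  · refine (isHomogeneous_linSubst _ (q.isHomogeneous i)).sub
      (MvPolynomial.IsHomogeneous.sum _ _ _ fun j _ => ?_)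
    rw [MvPolynomial.smul_eq_C_mul]
    exact (p.isHomogeneous j).C_mul _
  · have h1 : MvPolynomial.eval ![x, 1] (linSubst M (q.form i)) = (v i).eval x := by
      rw [eval_linSubst, hMx, hvx]
      rfl
    rw [map_sub, sub_eq_zero]
    refine h1.trans ?_
    rw [hcv, eval_mul, eval_C, affineTuple, eval_finsetSum, map_sum, Finset.mul_sum]
    refine Finset.sum_congr rfl fun j _ => ?_
    rw [eval_mul, eval_C, eval_dehom, MvPolynomial.smul_eval, mul_assoc]

end Reparametrization

/-! ### Stall forms under equivalence, and rigidity of nondegenerate curves -/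

variable {n d : ℕ}

theorem toMap_smul_eq {p q : Param n d} {A : GL (Fin (n + 1)) ℂ} {M : GL (Fin 2) ℂ} {c : ℂ}
    (h : ∀ i, linSubst (M : Matrix (Fin 2) (Fin 2) ℂ) (q.form i) =
      ∑ j, (c * A i j) • p.form j) (x : PSpace 1) :
    q.toMap ((Matrix.ProjGenLinGroup.mk M : PGL(Fin 2, ℂ)) • x) =
      (Matrix.ProjGenLinGroup.mk A : PGL(Fin (n + 1), ℂ)) • p.toMap x := by
  induction x using Projectivization.ind with
  | _ v hv =>
    rw [Projectivization.PGL.mk_smul_mk, Param.toMap_mk, Param.toMap_mk,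
      Projectivization.PGL.mk_smul_mk, Projectivization.mk_eq_mk_iff']
    refine ⟨c, funext fun i => ?_⟩
    have h1 : q.evalAt (M • v) i =
        MvPolynomial.eval v (linSubst (M : Matrix (Fin 2) (Fin 2) ℂ) (q.form i)) :=
      (eval_linSubst _ _ _).symm
    have h2 : (A • p.evalAt v) i = ∑ j, A i j * MvPolynomial.eval v (p.form j) := rfl
    rw [h1, h, map_sum, Pi.smul_apply, h2, smul_eq_mul, Finset.mul_sum]
    exact Finset.sum_congr rfl fun j _ => by rw [MvPolynomial.smul_eval, mul_assoc]

theorem mk_mem_formEquivs {p q : Param n d} {A : GL (Fin (n + 1)) ℂ} {M : GL (Fin 2) ℂ} {c : ℂ}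
    (hc : c ≠ 0) (h : ∀ i, linSubst (M : Matrix (Fin 2) (Fin 2) ℂ) (q.form i) =
      ∑ j, (c * A i j) • p.form j) :
    Matrix.ProjGenLinGroup.mk M ∈ formEquivs p.stallForm q.stallForm := by
  have hM : IsUnit (M : Matrix (Fin 2) (Fin 2) ℂ).det := (Matrix.isUnit_iff_isUnit_det _).mp M.isUnit
  have hA : IsUnit (A : Matrix (Fin (n + 1)) (Fin (n + 1)) ℂ).det :=
    (Matrix.isUnit_iff_isUnit_det _).mp A.isUnit
  obtain ⟨b, hb, hdet⟩ := exists_det_oscMatrix_linSubst hM n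
  have hcA := det_oscMatrix_linComb (c • (A : Matrix (Fin (n + 1)) (Fin (n + 1)) ℂ)) p.form
  have hq := hdet q.form
  rw [funext h] at hq
  -- Computing the osculation determinant of `q ∘ M = c A p` both ways gives `b · (Δ_q ∘ M) = det(c
  -- A) · Δ_p`, hence this factor.
  refine ⟨M, rfl, b⁻¹ * (c • (A : Matrix (Fin (n + 1)) (Fin (n + 1)) ℂ)).det, ?_, ?_⟩
  · rw [Matrix.det_smul]
    exact mul_ne_zero (inv_ne_zero hb) (mul_ne_zero (pow_ne_zero _ hc) hA.ne_zero)
  · rw [substForm_eq_linSubst, p.stallForm_eq_det_oscMatrix, q.stallForm_eq_det_oscMatrix, mul_smul,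
      ← hcA, eq_inv_smul_iff₀ hb, ← hq]
    rfl

/-- The pullback of the linear form `a` is a binary form vanishing at all affine points, hence zero;
a nonzero `a` would give a hyperplane containing the curve. -/
theorem Nondegenerate.eq_zero_of_forall_affine {C : Set (PSpace n)} (hC : Nondegenerate C)
    {p : Param n d} (hp : Set.range p.toMap = C) {a : Fin (n + 1) → ℂ}
    (ha : ∀ x, ∑ j, a j * MvPolynomial.eval ![x, 1] (p.form j) = 0) : a = 0 := by
  have h0 : ∑ j, MvPolynomial.C (a j) * p.form j = 0 :=
    eq_zero_of_eval_affine_eq_zero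
      (MvPolynomial.IsHomogeneous.sum _ _ _ fun j _ => (p.isHomogeneous j).C_mul _)
      fun x => by simpa using ha x
  by_contra hne
  refine hC a hne ?_
  rw [← hp]
  rintro _ ⟨x, rfl⟩
  induction x using Projectivization.ind with
  | _ v hv =>
    obtain ⟨r, hr⟩ := Projectivization.exists_smul_eq_mk_rep ℂ _ (p.evalAt_ne_zero hv)
    have hv0 : ∑ j, a j * p.evalAt v j = 0 := by
      simpa [Param.evalAt] using congrArg (MvPolynomial.eval v) h0
    change ∑ j, a j * (p.toMap (Projectivization.mk ℂ v hv)).rep j = 0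
    rw [Param.toMap_mk, ← hr]
    calc ∑ j, a j * (r • p.evalAt v) j = r * ∑ j, a j * p.evalAt v j := by
          rw [Finset.mul_sum]
          exact Finset.sum_congr rfl fun j _ => by
            rw [Units.smul_def, Pi.smul_apply, smul_eq_mul]
            ring
      _ = 0 := by rw [hv0, mul_zero]

/-- A projective transformation is determined by its restriction to a nondegenerate rational
curve. -/
theorem Nondegenerate.eq_of_forall_smul_toMap_eq {C : Set (PSpace n)} (hC : Nondegenerate C)
    {p : Param n d} (hp : Set.range p.toMap = C) {φ φ' : PGL(Fin (n + 1), ℂ)}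
    (h : ∀ x, φ • p.toMap x = φ' • p.toMap x) : φ = φ' := by
  induction φ using Matrix.ProjGenLinGroup.induction_on with
  | mk A =>
  induction φ' using Matrix.ProjGenLinGroup.induction_on with
  | mk B =>
  have hAB : ∀ i j, affineTuple A p i * affineTuple B p j =
      affineTuple A p j * affineTuple B p i := fun i j => Polynomial.funext fun x => by
    have := h (affinePoint x)
    rw [mk_smul_toMap_affinePoint, mk_smul_toMap_affinePoint, mk_eq_mk_iff_mul_eq_mul] at this
    rw [Polynomial.eval_mul, Polynomial.eval_mul]
    exact this i j
  obtain ⟨c, hc, hcB⟩ := exists_const_of_proportional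
    (fun x => Function.ne_iff.mp (eval_affineTuple_ne_zero A p x))
    (fun x => Function.ne_iff.mp (eval_affineTuple_ne_zero B p x)) hAB
  -- Each row of `B - c A` is a linear form vanishing on the curve.
  have hrow : ∀ i, (fun j => B i j - c * A i j) = 0 := fun i => by
    refine hC.eq_zero_of_forall_affine hp fun x => ?_
    have := congrArg (Polynomial.eval x) (hcB i)
    simp only [affineTuple, Polynomial.eval_mul, Polynomial.eval_finsetSum, Polynomial.eval_C,
      eval_dehom] at this
    simp only [sub_mul, Finset.sum_sub_distrib, mul_assoc, ← Finset.mul_sum]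
    rw [this, sub_self]
  rw [Matrix.ProjGenLinGroup.mk_eq_mk_iff]
  refine ⟨Units.mk0 c hc, Units.ext (Matrix.ext fun i j => ?_)⟩
  have := congrFun (hrow i) j
  rw [Pi.zero_apply, sub_eq_zero] at this
  rw [this]
  simp [mul_comm]

theorem IsInvComp.of_forall_eq {p q : Param n d} {φ : PGL(Fin (n + 1), ℂ)} {ψ : PGL(Fin 2, ℂ)}
    (hq : q.IsBirational) (hp : p.IsBirational)
    (h : ∀ x, q.toMap (ψ • x) = φ • p.toMap x) : IsInvComp q φ p ψ := by
  obtain ⟨S, hS, hpS⟩ := hp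
  obtain ⟨T, hT, hqT⟩ := hq
  have hrange : (Set.range fun x => φ • p.toMap x) = Set.range q.toMap := by
    rw [← funext h]
    exact (MulAction.surjective ψ).range_comp q.toMap
  have hfS : Set.InjOn (fun x => φ • p.toMap x) Sᶜ :=
    fun x hx y hy hxy => hpS hx hy (MulAction.injective _ hxy)
  filter_upwards [eventually_exists_unique_preimage hrange hS hfS hT hqT Set.finite_empty]
    with x ⟨y, _, hy⟩
  have hψ := (hy (ψ • x)).mp (h x)
  ext z
  rw [hψ]
  exact hy z

end RatCurve

/-! ### The inclusion of automorphism sets -/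

theorem mainTheorem1 (n d : ℕ) (hd : n < d)
    (C D : Set (RatCurve.PSpace n)) (p q : RatCurve.Param n d)
    (hp : RatCurve.IsRationalCurve C p) (hq : RatCurve.IsRationalCurve D q)
    (hC : RatCurve.Nondegenerate C) (hD : RatCurve.Nondegenerate D) :
    ∃ ι : RatCurve.equivs C D → RatCurve.formEquivs p.stallForm q.stallForm,
      Function.Injective ι ∧
      ∀ φ : RatCurve.equivs C D,
        RatCurve.IsInvComp q (φ : PGL(Fin (n + 1), ℂ)) p (ι φ : PGL(Fin 2, ℂ)) ∧
        ∀ x : RatCurve.PSpace 1,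
          q.toMap ((ι φ : PGL(Fin 2, ℂ)) • x) = (φ : PGL(Fin (n + 1), ℂ)) • p.toMap x := by
  have key : ∀ φ : RatCurve.equivs C D, ∃ ψ : RatCurve.formEquivs p.stallForm q.stallForm,
      ∀ x : RatCurve.PSpace 1,
        q.toMap ((ψ : PGL(Fin 2, ℂ)) • x) = (φ : PGL(Fin (n + 1), ℂ)) • p.toMap x := by
    rintro ⟨φ, hφ⟩
    obtain ⟨A, rfl⟩ := Matrix.ProjGenLinGroup.mk_surjective φ
    have hrange : (Set.range fun x =>
        (Matrix.ProjGenLinGroup.mk A : PGL(Fin (n + 1), ℂ)) • p.toMap x) = Set.range q.toMap := by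
      have himage : (fun x => (Matrix.ProjGenLinGroup.mk A : PGL(Fin (n + 1), ℂ)) • x) '' C = D := hφ
      rw [hq.range_eq, ← himage, ← hp.range_eq, ← Set.range_comp]
      rfl
    obtain ⟨M, c, hc, hM⟩ := RatCurve.exists_linSubst_eq (Nat.zero_lt_of_lt hd) p q A
      hp.isBirational hq.isBirational hrange
    exact ⟨⟨_, RatCurve.mk_mem_formEquivs hc hM⟩, RatCurve.toMap_smul_eq hM⟩
  choose ι hι using key
  refine ⟨ι, fun φ φ' h => Subtype.ext ?_, fun φ =>
    ⟨RatCurve.IsInvComp.of_forall_eq hq.isBirational hp.isBirational (hι φ), hι φ⟩⟩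
  -- Both `φ ∘ p` and `φ' ∘ p` equal `q` composed with the common value of `ι`.
  refine hC.eq_of_forall_smul_toMap_eq hp.range_eq fun x => ?_
  rw [← hι, ← hι, h]
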